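/- Let $\mathcal G=(\mathcal V,\mathcal E,W)$ be a finite weighted digraph on a nonempty vertex set: $W$ is a nonnegative real matrix (loops allowed) and there is an arc from $i$ to $j$ exactly when $W_{ij}>0$. Assume that $\mathcal G$ is strongly connected (every vertex is reachable from every other one along arcs) and that every degree $d_i=\sum_j W_{ij}$ is positive (automatic if there are at least two vertices). Let $d_{\mathcal G}=\sum_i d_i$ be the volume, and let the random walk on $\mathcal G$ be the Markov chain $(X_n)_{n\ge 0}$ with transition matrix $P_{ij}=W_{ij}/d_i$. Then there is a unique stationary distribution $\pi$ (a probability vector with $\pi^\top P=\pi^\top$), and $\pi_i>0$ for all $i$. Let $H(i,j)$ be the expected value, for the walk started at $i$, of the first time $n\ge 0$ with $X_n=j$. Let $C(i,j)$ be the commute time: the expected time, for the walk started at $i$, at which it is first at $i$ at or after its first visit to $j$. For $i\ne j$, let $P_{\mathrm{es}}(i,j)$ be the probability that the walk started at $i$ reaches $j$ before it returns to $i$. Let the resistance distance be $\Omega(i,j)=\dfrac{1}{d_{\mathcal G}\,\pi_i\,P_{\mathrm{es}}(i,j)}$ for $i\neq j$ and $\Omega(i,i)=0$. Then: 1. for every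 vertex $i$, the expected time of the first return to $i$ (at a time $n\ge 1$) of the walk started at $i$ equals $1/\pi_i$; 2. for all vertices $i,j$, $C(i,j)=H(i,j)+H(j,i)$ is finite and $$\Omega(i,j)=\frac{C(i,j)}{d_{\mathcal G}};$$ 3. for all vertices $i\ne j$, $P_{\mathrm{es}}(i,j)>0$ and $$P_{\mathrm{es}}(i,j)=\frac{1}{\pi_i\,C(i,j)}.$$ -/

import Mathlib

open MeasureTheory ProbabilityTheory
open scoped ENNReal Matrix

/-- A finite weighted digraph with nonnegative weighted adjacency matrix `weight`; there is an
arc from `i` to `j` exactly when `0 < weight i j`. Loops are allowed. -/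
structure WeightedDigraph (V : Type*) where
  weight : Matrix V V ℝ
  weight_nonneg : ∀ i j, 0 ≤ weight i j

noncomputable section

namespace WeightedDigraph

variable {V : Type*} (G : WeightedDigraph V)

/-- There is an arc from `i` to `j`. -/
def Arc (i j : V) : Prop := 0 < G.weight i j

/-- Every vertex can be reached from every other vertex along arcs. -/
def StronglyConnected : Prop := ∀ i j : V, Relation.ReflTransGen G.Arc i j

variable [Fintype V]

/-- The (out-)degree of a vertex. -/
def degree (i : V) : ℝ := ∑ j, G.weight i j

/-- The volume of the digraph. -/
def vol : ℝ := ∑ i, G.degree i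

/-- The transition probability matrix of the random walk, the inverse of the degree matrix times
the adjacency matrix. -/
def transition : Matrix V V ℝ := Matrix.of fun i j => G.weight i j / G.degree i

/-- A probability vector invariant under the transition matrix. -/
def IsStationary (π : V → ℝ) : Prop :=
  π ∈ stdSimplex ℝ V ∧ π ᵥ* G.transition = π

/-- The stationary distribution (for a strongly connected digraph with positive degrees it is
the only vector satisfying `IsStationary`). -/
def stationary : V → ℝ := Classical.epsilon G.IsStationary

theorem sum_transition {i : V} (h : 0 < G.degree i) :
    ∑ j, ENNReal.ofReal (G.transition i j) = 1 := by
  have h0 : ∀ j ∈ Finset.univ, 0 ≤ G.transition i j :=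
    fun j _ => div_nonneg (G.weight_nonneg i j) h.le
  have h1 : ∑ j, G.transition i j = 1 := by
    simp only [transition, Matrix.of_apply]
    rw [← Finset.sum_div]
    exact div_self h.ne'
  rw [← ENNReal.ofReal_sum_of_nonneg h0, h1, ENNReal.ofReal_one]

open Classical in
/-- The law of one step of the walk from `i`: it jumps to `j` with probability
`transition i j`. (A vertex of degree zero, where that is not defined, is made absorbing.) -/
def step (i : V) : PMF V :=
  if h : 0 < G.degree i then
    PMF.ofFintype (fun j => ENNReal.ofReal (G.transition i j)) (G.sum_transition h)
  else PMF.pure i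

variable [MeasurableSpace V] [MeasurableSingletonClass V]

/-- The one-step transition kernel of the walk. -/
def stepKernel : Kernel V V := Kernel.ofFunOfCountable fun i => (G.step i).toMeasure

instance : IsMarkovKernel G.stepKernel :=
  ⟨fun i => by
    change IsProbabilityMeasure (G.step i).toMeasure
    infer_instance⟩

/-- The kernel giving the position at time `n + 1` from the positions at times `0, …, n`;
it depends on the position at time `n` only. -/
def historyKernel (n : ℕ) : Kernel ((k : Finset.Iic n) → V) V :=
  G.stepKernel.comap (fun x => x ⟨n, Finset.mem_Iic.2 le_rfl⟩) (measurable_pi_apply _)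

instance (n : ℕ) : IsMarkovKernel (G.historyKernel n) := by
  unfold historyKernel
  infer_instance

/-- The law, on the space `ℕ → V` of trajectories, of the random walk started at `i`: the Markov
chain with transition matrix `transition` and initial position `i`. -/
def walk (i : V) : Measure (ℕ → V) :=
  Kernel.trajMeasure (X := fun _ => V) (Measure.dirac i) G.historyKernel

end WeightedDigraph

/-- The first time at which `p` holds, `∞` if there is none. -/
def firstTime (p : ℕ → Prop) : ℝ≥0∞ := ⨅ (n : ℕ) (_ : p n), (n : ℝ≥0∞)

namespace WeightedDigraph

variable {V : Type*} [Fintype V] [MeasurableSpace V] [MeasurableSingletonClass V]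
  (G : WeightedDigraph V)

/-- Hitting time `H(i,j)`: the expected time at which the walk started at `i` first visits `j`
(time `0` counts, so that `H(i,i) = 0`). -/
def hittingTime (i j : V) : ℝ≥0∞ := ∫⁻ ω, firstTime (fun n => ω n = j) ∂(G.walk i)

/-- The expected time of the first return to `i` (at a positive time) of the walk started
at `i`. -/
def returnTime (i : V) : ℝ≥0∞ := ∫⁻ ω, firstTime (fun n => 1 ≤ n ∧ ω n = i) ∂(G.walk i)

/-- Commute time `C(i,j)`: the expected time at which the walk started at `i` is first back at `i`
after having visited `j`. -/
def commuteTime (i j : V) : ℝ≥0∞ :=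
  ∫⁻ ω, firstTime (fun n => ω n = i ∧ ∃ m ≤ n, ω m = j) ∂(G.walk i)

/-- Escape probability: the probability that the walk started at `i` reaches `j` before it
returns to `i` (meant for `i ≠ j`). -/
def escapeProb (i j : V) : ℝ :=
  (G.walk i).real {ω | ∃ n, 1 ≤ n ∧ ω n = j ∧ ∀ m, 1 ≤ m → m < n → ω m ≠ i}

open Classical in
/-- The resistance distance of the digraph. -/
def resistance (i j : V) : ℝ :=
  if i = j then 0 else 1 / (G.vol * G.stationary i * G.escapeProb i j)

end WeightedDigraph

end

/-! Everything is one-step analysis combined with uniqueness for linear equations. By `walk_eq_sum`,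
the law of the walk from `i` is the mixture, over the first step `j`, of the laws from `j` with `i`
prepended. Hence expected times and hitting probabilities satisfy discrete Poisson equations. Strong
connectivity gives a maximum principle, so such an equation has at most one solution with given
values on a nonempty set (`eq_of_poisson`). Identities between real quantities are proved by
checking that both sides solve the same problem, once finiteness is known from comparison with a
supersolution (`lintegral_walk_le`).

Write `H`, `C`, `R` for the hitting, commute and return times. Pairing an invariant vector `μ` with
the equations for `H(·,i)` gives Kac's formula `μ i * R i = ∑ k, μ k`. This yields existence,
uniqueness and positivity of the stationary distribution, with `π i = 1 / R i`. The probability of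
visiting `j` before `i` from `k` is `(H(k,i) + H(i,j) - H(k,j)) / C(i,j)`. Averaging over the first
step from `i` gives escape probability `R i / C(i,j)`, and the claims about resistance follow. -/

namespace MeasureTheory

/-! ### The law of the trajectory and the Markov property at time one. -/

/-- A finite measure on sequences in a finite discrete space is determined by its values on
initial cylinders. -/
theorem Measure.ext_of_initial_cylinder {V : Type*} [Finite V] [MeasurableSpace V]
    [MeasurableSingletonClass V] {μ ν : Measure (ℕ → V)} [IsFiniteMeasure μ]
    (h : ∀ (n : ℕ) (x : ℕ → V),
      μ {ω | ∀ k ≤ n, ω k = x k} = ν {ω | ∀ k ≤ n, ω k = x k}) : μ = ν := by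
  rcases isEmpty_or_nonempty V with hV | ⟨⟨v⟩⟩
  · exact Subsingleton.elim _ _
  have key : ∀ n, μ.map (Preorder.frestrictLe n) = ν.map (Preorder.frestrictLe n) := by
    intro n
    refine Measure.ext_of_singleton fun a => ?_
    rw [Measure.map_apply (Preorder.measurable_frestrictLe n) (measurableSet_singleton a),
      Measure.map_apply (Preorder.measurable_frestrictLe n) (measurableSet_singleton a)]
    -- The filler `v` beyond time `n` is never read.
    have hs : (Preorder.frestrictLe (π := fun _ : ℕ => V) n) ⁻¹' {a} =
        {ω | ∀ k ≤ n, ω k = (fun m => if hm : m ≤ n then a ⟨m, Finset.mem_Iic.2 hm⟩ else v) k} := by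
      ext ω
      simp only [Set.mem_preimage, Set.mem_singleton_iff, Set.mem_ofPred_eq, funext_iff,
        Subtype.forall, Finset.mem_Iic, Preorder.frestrictLe_apply]
      refine forall_congr' fun k => forall_congr' fun hk => ?_
      rw [dif_pos hk]
    rw [hs, h]
  have hlim : IsProjectiveLimit ν (fun I : Finset ℕ => μ.map I.restrict) := by
    rw [isProjectiveLimit_nat_iff]
    · exact fun n => (key n).symm
    · exact isProjectiveMeasureFamily_map_restrict (X := fun n (ω : ℕ → V) => ω n) fun n =>
        (measurable_pi_apply n).aemeasurable
  exact IsProjectiveLimit.unique (P := fun I : Finset ℕ => μ.map I.restrict)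
    (fun I => rfl) hlim

end MeasureTheory

/-- Prepend a state to a trajectory. -/
def consPath {V : Type*} (i : V) (ω : ℕ → V) : ℕ → V
  | 0 => i
  | n + 1 => ω n

theorem measurable_consPath {V : Type*} [MeasurableSpace V] (i : V) :
    Measurable (consPath i) :=
  measurable_pi_lambda _ fun n => by
    cases n with
    | zero => exact measurable_const
    | succ n => exact measurable_pi_apply n

namespace WeightedDigraph

variable {V : Type*} [Fintype V] [MeasurableSpace V] [MeasurableSingletonClass V]
  (G : WeightedDigraph V)

theorem stepKernel_singleton {i : V} (h : 0 < G.degree i) (j : V) :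
    G.stepKernel i {j} = ENNReal.ofReal (G.transition i j) := by
  change (G.step i).toMeasure {j} = _
  rw [PMF.toMeasure_apply_singleton _ _ (measurableSet_singleton j), step, dif_pos h,
    PMF.ofFintype_apply]

instance (i : V) : IsProbabilityMeasure (G.walk i) := by
  unfold walk
  infer_instance

theorem walk_initial_zero (i : V) (x : ℕ → V) :
    G.walk i {ω | ∀ k ≤ 0, ω k = x k} = Set.indicator {x 0} 1 i := by
  have hm : (G.walk i).map (Preorder.frestrictLe 0) =
      (Measure.dirac i).map
        (MeasurableEquiv.piUnique (fun _ : Finset.Iic 0 => V)).symm := by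
    rw [walk, Kernel.trajMeasure, Measure.map_comp _ _ (by fun_prop),
      Kernel.traj_map_frestrictLe, Kernel.partialTraj_self, Measure.id_comp]
  have hs : {ω : ℕ → V | ∀ k ≤ 0, ω k = x k} = (Preorder.frestrictLe 0) ⁻¹'
      {a : Finset.Iic 0 → V | a ⟨0, by simp⟩ = x 0} := by
    ext ω
    simp
  have hms : MeasurableSet {a : Finset.Iic 0 → V | a ⟨0, by simp⟩ = x 0} :=
    measurableSet_eq_fun (measurable_pi_apply _) measurable_const
  rw [hs, ← Measure.map_apply (Preorder.measurable_frestrictLe 0) hms, hm,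
    Measure.map_apply (by fun_prop) hms, Measure.dirac_apply]
  rfl

theorem walk_initial_succ (i : V) (n : ℕ) (x : ℕ → V) :
    G.walk i {ω | ∀ k ≤ n + 1, ω k = x k} =
      G.walk i {ω | ∀ k ≤ n, ω k = x k} * G.stepKernel (x n) {x (n + 1)} := by
  have h := Kernel.map_frestrictLe_trajMeasure_compProd_eq_map_trajMeasure
    (X := fun _ => V) (μ₀ := Measure.dirac i) (κ := G.historyKernel) (a := n)
  have h2 := congrArg (fun μ => μ ({Preorder.frestrictLe n x} ×ˢ {x (n + 1)})) h
  beta_reduce at h2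
  have hms : MeasurableSet ({Preorder.frestrictLe (π := fun _ : ℕ => V) n x} :
      Set ((k : Finset.Iic n) → V)) := measurableSet_singleton _
  rw [Measure.compProd_apply_prod hms (measurableSet_singleton _),
    lintegral_singleton,
    Measure.map_apply (Preorder.measurable_frestrictLe n) hms,
    Measure.map_apply (by fun_prop) (hms.prod (measurableSet_singleton _))] at h2
  have hs : {ω : ℕ → V | ∀ k ≤ n, ω k = x k} =
      (Preorder.frestrictLe (π := fun _ : ℕ => V) n) ⁻¹' {Preorder.frestrictLe n x} := by
    ext ω
    simp [funext_iff]
  have hs' : {ω : ℕ → V | ∀ k ≤ n + 1, ω k = x k} =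
      (fun ω : ℕ → V => (Preorder.frestrictLe (π := fun _ : ℕ => V) n ω, ω (n + 1))) ⁻¹'
        ({Preorder.frestrictLe n x} ×ˢ {x (n + 1)}) := by
    ext ω
    simp only [Set.mem_ofPred_eq, Set.mem_preimage, Set.mem_prod, Set.mem_singleton_iff,
      funext_iff, Subtype.forall, Finset.mem_Iic, Preorder.frestrictLe_apply]
    constructor
    · exact fun H => ⟨fun k hk => H k (by omega), H _ le_rfl⟩
    · rintro ⟨H1, H2⟩ k hk
      rcases Nat.le_succ_iff.1 hk with hk | rfl
      · exact H1 k hk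
      · exact H2
  rw [hs, hs', mul_comm]
  exact h2.symm

/-- A cylinder's probability is a product of transition probabilities. `walk_initial_succ` splits
off the last factor; the induction regroups so that the first one is split off. -/
theorem walk_initial_shift (i : V) (n : ℕ) (x : ℕ → V) :
    G.walk i {ω | ∀ k ≤ n + 1, ω k = x k} =
      Set.indicator {x 0} 1 i * (G.stepKernel i {x 1} *
        G.walk (x 1) {ω | ∀ k ≤ n, ω k = x (k + 1)}) := by
  induction n with
  | zero =>
    rw [walk_initial_succ, walk_initial_zero, G.walk_initial_zero (x 1) (fun k => x (k + 1))]
    by_cases h : i = x 0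
    · simp [h]
    · simp [h]
  | succ n ih =>
    rw [walk_initial_succ, ih, G.walk_initial_succ (x 1) n (fun k => x (k + 1))]
    ring

/-- The Markov property of the walk at time one. -/
theorem walk_eq_sum (i : V) :
    G.walk i = ∑ j, G.stepKernel i {j} • (G.walk j).map (consPath i) := by
  classical
  refine Measure.ext_of_initial_cylinder fun n x => ?_
  have hms (n : ℕ) : MeasurableSet {ω : ℕ → V | ∀ k ≤ n, ω k = x k} := by
    measurability
  simp only [Measure.finsetSum_apply, Measure.smul_apply, smul_eq_mul,
    Measure.map_apply (measurable_consPath i) (hms n)]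
  cases n with
  | zero =>
    have hs : (consPath i) ⁻¹' {ω : ℕ → V | ∀ k ≤ 0, ω k = x k} = {_ω | i = x 0} := by
      ext ω
      simp [consPath]
    rw [walk_initial_zero, hs]
    by_cases h : i = x 0 <;> simp [h]
  | succ n =>
    have hs : (consPath i) ⁻¹' {ω : ℕ → V | ∀ k ≤ n + 1, ω k = x k} =
        {ω | i = x 0 ∧ ∀ k ≤ n, ω k = x (k + 1)} := by
      ext ω
      simp only [Set.mem_preimage, Set.mem_ofPred_eq]
      constructor
      · exact fun H => ⟨H 0 (by omega), fun k hk => H (k + 1) (by omega)⟩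
      · rintro ⟨H1, H2⟩ (_ | k) hk
        · exact H1
        · exact H2 k (by omega)
    rw [walk_initial_shift, hs]
    by_cases h : i = x 0
    · simp only [h, true_and]
      -- The walk from `j` starts at `j`, so only the term `j = x 1` charges the cylinder.
      rw [Finset.sum_eq_single (x 1)]
      · simp
      · intro j _ hj
        have := G.walk_initial_zero j (fun k => x (k + 1))
        rw [Set.indicator_of_notMem (by simpa using hj)] at this
        rw [measure_mono_null _ this, mul_zero]
        exact fun ω hω k hk => hω k (by omega)
      · simp
    · simp [h]

theorem lintegral_walk {f : (ℕ → V) → ℝ≥0∞} (hf : Measurable f) {i : V} (h : 0 < G.degree i) :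
    ∫⁻ ω, f ω ∂G.walk i =
      ∑ j, ENNReal.ofReal (G.transition i j) * ∫⁻ ω, f (consPath i ω) ∂G.walk j := by
  rw [walk_eq_sum, lintegral_finsetSum_measure]
  refine Finset.sum_congr rfl fun j _ => ?_
  rw [lintegral_smul_measure, lintegral_map hf (measurable_consPath i),
    G.stepKernel_singleton h, smul_eq_mul]

end WeightedDigraph

/-! ### Maximum principle, Poisson equations and invariant vectors. -/

namespace WeightedDigraph

variable {V : Type*} [Fintype V] (G : WeightedDigraph V)

theorem transition_nonneg {i : V} (h : 0 < G.degree i) (j : V) : 0 ≤ G.transition i j :=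
  div_nonneg (G.weight_nonneg i j) h.le

theorem transition_pos {i j : V} (h : 0 < G.degree i) (ha : G.Arc i j) : 0 < G.transition i j :=
  div_pos ha h

theorem sum_transition_eq_one {i : V} (h : 0 < G.degree i) : ∑ j, G.transition i j = 1 := by
  simp only [transition, Matrix.of_apply]
  rw [← Finset.sum_div]
  exact div_self h.ne'

variable {G}

/-- The maximum principle: a function that is subharmonic outside `B` and nonpositive on the
nonempty set `B` is nonpositive. -/
theorem StronglyConnected.nonpos_of_subharmonic (hconn : G.StronglyConnected)
    (hdeg : ∀ i, 0 < G.degree i) {B : Set V} (hB : B.Nonempty) {g : V → ℝ}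
    (hg : ∀ k ∉ B, g k ≤ ∑ l, G.transition k l * g l) (hgB : ∀ k ∈ B, g k ≤ 0) (k : V) :
    g k ≤ 0 := by
  obtain ⟨b, hb⟩ := hB
  have : Nonempty V := ⟨b⟩
  obtain ⟨m, hm⟩ := Finite.exists_max g
  refine (hm k).trans ?_
  by_contra! hpos
  -- A positive maximum propagates along arcs: a point attaining it lies outside `B`, and there
  -- subharmonicity forces every out-neighbour to attain it too. Following arcs from `m` to `b ∈ B`
  -- gives the contradiction.
  have hall : ∀ l, Relation.ReflTransGen G.Arc m l → g l = g m := by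
    intro l hl
    induction hl with
    | refl => rfl
    | @tail x y _ hxy ih =>
      have hx : x ∉ B := fun hx => (hgB x hx).not_gt (ih ▸ hpos)
      refine (hm y).antisymm ?_
      by_contra! hy
      have hlt : ∑ l, G.transition x l * g l < ∑ l, G.transition x l * g m :=
        Finset.sum_lt_sum
          (fun l _ => mul_le_mul_of_nonneg_left (hm l) (G.transition_nonneg (hdeg x) l))
          ⟨y, Finset.mem_univ y, mul_lt_mul_of_pos_left hy (G.transition_pos (hdeg x) hxy)⟩
      rw [← Finset.sum_mul, G.sum_transition_eq_one (hdeg x), one_mul] at hlt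
      linarith [hg x hx]
  exact (hgB b hb).not_gt (hall b (hconn m b) ▸ hpos)

/-- Two functions with the same values on a nonempty set `B` and the same Laplacian outside `B`
are equal. -/
theorem StronglyConnected.eq_of_poisson (hconn : G.StronglyConnected)
    (hdeg : ∀ i, 0 < G.degree i) {B : Set V} (hB : B.Nonempty) {c f g : V → ℝ}
    (hf : ∀ k ∉ B, f k = c k + ∑ l, G.transition k l * f l)
    (hg : ∀ k ∉ B, g k = c k + ∑ l, G.transition k l * g l)
    (hfg : ∀ k ∈ B, f k = g k) : f = g := by
  have key : ∀ {f g : V → ℝ}, (∀ k ∉ B, f k = c k + ∑ l, G.transition k l * f l) →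
      (∀ k ∉ B, g k = c k + ∑ l, G.transition k l * g l) → (∀ k ∈ B, f k = g k) →
      ∀ k, f k ≤ g k := by
    intro f g hf hg hfg k
    refine sub_nonpos.1 (hconn.nonpos_of_subharmonic hdeg hB (g := fun k => f k - g k) ?_ ?_ k)
    · intro k hk
      simp only [mul_sub, Finset.sum_sub_distrib]
      linarith [hf k hk, hg k hk]
    · exact fun k hk => (sub_eq_zero.2 (hfg k hk)).le
  exact funext fun k => (key hf hg hfg k).antisymm (key hg hf (fun k hk => (hfg k hk).symm) k)

/-- There is a nonnegative function whose Laplacian is one outside `j`. -/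
theorem StronglyConnected.exists_expected_time (hconn : G.StronglyConnected)
    (hdeg : ∀ i, 0 < G.degree i) (j : V) :
    ∃ h : V → ℝ, (∀ k, 0 ≤ h k) ∧ ∀ k ≠ j, h k = 1 + ∑ l, G.transition k l * h l := by
  classical
  -- The Laplacian with its row at `j` replaced by evaluation at `j`. Uniqueness makes it injective,
  -- hence surjective in finite dimension.
  let L : (V → ℝ) →ₗ[ℝ] (V → ℝ) :=
    { toFun := fun g k => if k = j then g k else g k - ∑ l, G.transition k l * g l
      map_add' := fun f g => by
        ext k
        simp only [Pi.add_apply, mul_add, Finset.sum_add_distrib]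
        split_ifs <;> ring
      map_smul' := fun c g => by
        ext k
        simp only [Pi.smul_apply, smul_eq_mul, RingHom.id_apply, mul_left_comm _ c,
          ← Finset.mul_sum]
        split_ifs <;> ring }
  have hL : ∀ g k, L g k = if k = j then g k else g k - ∑ l, G.transition k l * g l :=
    fun _ _ => rfl
  have hinj : Function.Injective L := by
    rw [← LinearMap.ker_eq_bot, LinearMap.ker_eq_bot']
    intro g hg
    refine hconn.eq_of_poisson hdeg (B := {j}) (c := 0) (Set.singleton_nonempty j) ?_ ?_ ?_
    · intro k hk
      have := congrFun hg k
      rw [hL, if_neg (Set.mem_singleton_iff.not.1 hk)] at this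
      simpa [sub_eq_zero] using this
    · simp
    · rintro k rfl
      simpa [hL] using congrFun hg k
  obtain ⟨h, hh⟩ := LinearMap.injective_iff_surjective.1 hinj fun k => if k = j then 0 else 1
  have hj : h j = 0 := by simpa [hL] using congrFun hh j
  have heq : ∀ k ≠ j, h k = 1 + ∑ l, G.transition k l * h l := by
    intro k hk
    have := congrFun hh k
    rw [hL, if_neg hk, if_neg hk] at this
    linarith
  refine ⟨h, fun k => ?_, heq⟩
  refine neg_nonpos.1 (hconn.nonpos_of_subharmonic hdeg (B := {j}) (Set.singleton_nonempty j)
    (g := fun k => - h k) ?_ ?_ k)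
  · intro k hk
    simp only [mul_neg, Finset.sum_neg_distrib]
    linarith [heq k hk]
  · rintro k rfl
    simp [hj]

theorem sum_ofReal_transition {i : V} (h : 0 < G.degree i) (f : V → ℝ≥0∞) (hf : ∀ j, f j ≠ ⊤) :
    (∑ j, ENNReal.ofReal (G.transition i j) * f j).toReal =
      ∑ j, G.transition i j * (f j).toReal := by
  rw [ENNReal.toReal_sum fun j _ => ENNReal.mul_ne_top ENNReal.ofReal_ne_top (hf j)]
  refine Finset.sum_congr rfl fun j _ => ?_
  rw [ENNReal.toReal_mul, ENNReal.toReal_ofReal (G.transition_nonneg h j)]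

theorem sum_ofReal_transition_ne_top (i : V) {f : V → ℝ≥0∞} (hf : ∀ j, f j ≠ ⊤) :
    ∑ j, ENNReal.ofReal (G.transition i j) * f j ≠ ⊤ :=
  ENNReal.sum_ne_top.2 fun j _ => ENNReal.mul_ne_top ENNReal.ofReal_ne_top (hf j)

theorem vecMul_transition_apply (μ : V → ℝ) (l : V) :
    (μ ᵥ* G.transition) l = ∑ k, μ k * G.transition k l := rfl

/-- The transition matrix has a nonzero invariant vector. -/
theorem exists_invariant [Nonempty V] (hdeg : ∀ i, 0 < G.degree i) :
    ∃ μ : V → ℝ, μ ≠ 0 ∧ μ ᵥ* G.transition = μ := by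
  classical
  -- The constant vector is a right null vector of `1 - P`, so a left null vector exists as well.
  -- Its signs are not controlled here.
  have hdet : (1 - G.transition).det = 0 := by
    refine Matrix.exists_mulVec_eq_zero_iff.1 ⟨1, one_ne_zero, ?_⟩
    rw [Matrix.sub_mulVec, Matrix.one_mulVec, sub_eq_zero]
    ext k
    simp [Matrix.mulVec, dotProduct, G.sum_transition_eq_one (hdeg k)]
  obtain ⟨μ, h0, hμ⟩ := Matrix.exists_vecMul_eq_zero_iff.2 hdet
  rw [Matrix.vecMul_sub, Matrix.vecMul_one, sub_eq_zero] at hμ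
  exact ⟨μ, h0, hμ.symm⟩

/-- Kac's formula for the solution of the hitting time equations. -/
theorem invariant_mul_expected_return {μ h : V → ℝ}
    (hμ : μ ᵥ* G.transition = μ) {i : V} (hi : h i = 0)
    (hh : ∀ k ≠ i, h k = 1 + ∑ l, G.transition k l * h l) :
    μ i * (1 + ∑ l, G.transition i l * h l) = ∑ k, μ k := by
  classical
  have h1 : ∑ k, μ k * ∑ l, G.transition k l * h l = ∑ l, μ l * h l := by
    simp only [Finset.mul_sum]
    rw [Finset.sum_comm]
    refine Finset.sum_congr rfl fun l _ => ?_
    conv_rhs => rw [← hμ, vecMul_transition_apply, Finset.sum_mul]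
    exact Finset.sum_congr rfl fun k _ => by ring
  -- Since `h i = 0`, the equation for `h` fails at `i` by exactly the expected return time. Summed
  -- against `μ`, the terms in `h` cancel by invariance.
  have h2 : ∀ k, μ k * h k = μ k + μ k * ∑ l, G.transition k l * h l -
      if k = i then μ i * (1 + ∑ l, G.transition i l * h l) else 0 := by
    intro k
    split_ifs with hk
    · subst hk
      rw [hi]
      ring
    · rw [hh k hk]
      ring
  have h3 := Finset.sum_congr rfl fun k (_ : k ∈ Finset.univ) => h2 k
  rw [Finset.sum_sub_distrib, Finset.sum_add_distrib, h1, Finset.sum_ite_eq' Finset.univ i,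
    if_pos (Finset.mem_univ i)] at h3
  linarith

end WeightedDigraph

/-! ### First times along a single trajectory. -/

theorem firstTime_of_zero {p : ℕ → Prop} (h : p 0) : firstTime p = 0 :=
  nonpos_iff_eq_zero.1 ((iInf₂_le 0 h).trans (by simp))

theorem firstTime_succ {p : ℕ → Prop} (h : ¬ p 0) :
    firstTime p = 1 + firstTime fun n => p (n + 1) := by
  unfold firstTime
  rw [← inf_iInf_nat_succ, iInf_neg h, top_inf_eq, ENNReal.add_iInf]
  refine iInf_congr fun n => ?_
  by_cases hn : p (n + 1)
  · simp [hn, add_comm]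
  · simp [hn]

theorem measurable_firstTime {Ω : Type*} [MeasurableSpace Ω] {p : Ω → ℕ → Prop}
    (hp : ∀ n, MeasurableSet {ω | p ω n}) : Measurable fun ω => firstTime (p ω) := by
  classical
  unfold firstTime
  refine Measurable.iInf fun n => ?_
  have : (fun ω => ⨅ (_ : p ω n), (n : ℝ≥0∞)) = fun ω => if p ω n then (n : ℝ≥0∞) else ⊤ := by
    ext ω
    split_ifs with h <;> simp [h]
  rw [this]
  exact Measurable.ite (hp n) measurable_const measurable_const

/-! ### First-step equations for hitting, return and commute times. -/

namespace WeightedDigraph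

theorem firstTime_hitting_consPath {V : Type*} {j k : V} (hk : k ≠ j) (ω : ℕ → V) :
    (firstTime fun n => consPath k ω n = j) = 1 + firstTime fun n => ω n = j :=
  firstTime_succ hk

/-- The trajectories that visit `j` before `i`. -/
def visitsBefore {V : Type*} (j i : V) : Set (ℕ → V) := {ω | ∃ n, ω n = j ∧ ∀ m < n, ω m ≠ i}

/-- Prepending a state other than `i` and `j` does not affect which is visited first; this makes the
probability of the event harmonic off `{i, j}`. -/
theorem preimage_consPath_visitsBefore {V : Type*} {i j k : V} (hi : k ≠ i) (hj : k ≠ j) :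
    consPath k ⁻¹' visitsBefore j i = visitsBefore j i := by
  ext ω
  constructor
  · rintro ⟨_ | n, hn, h⟩
    · exact absurd hn hj
    · exact ⟨n, hn, fun m hm => h (m + 1) (by omega)⟩
  · rintro ⟨n, hn, h⟩
    refine ⟨n + 1, hn, ?_⟩
    rintro (_ | m) hm
    · exact hi
    · exact h m (by omega)

variable {V : Type*} [Fintype V] [MeasurableSpace V] [MeasurableSingletonClass V]
  {G : WeightedDigraph V}

theorem measurableSet_eval_eq (n : ℕ) (j : V) : MeasurableSet {ω : ℕ → V | ω n = j} :=
  measurableSet_eq_fun (measurable_pi_apply n) measurable_const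

theorem measurable_hitting (j : V) :
    Measurable fun ω : ℕ → V => firstTime fun n => ω n = j :=
  measurable_firstTime fun n => measurableSet_eval_eq n j

theorem measurable_return (i : V) :
    Measurable fun ω : ℕ → V => firstTime fun n => 1 ≤ n ∧ ω n = i :=
  measurable_firstTime fun n => (MeasurableSet.const _).inter (measurableSet_eval_eq n i)

theorem measurable_commute (i j : V) :
    Measurable fun ω : ℕ → V => firstTime fun n => ω n = i ∧ ∃ m ≤ n, ω m = j := by
  refine measurable_firstTime fun n => (measurableSet_eval_eq n i).inter ?_
  have : {ω : ℕ → V | ∃ m ≤ n, ω m = j} = ⋃ m, ⋃ (_ : m ≤ n), {ω | ω m = j} := by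
    ext ω
    simp
  change MeasurableSet {ω : ℕ → V | ∃ m ≤ n, ω m = j}
  rw [this]
  exact MeasurableSet.iUnion fun m => MeasurableSet.iUnion fun _ => measurableSet_eval_eq m j

/-- The walk from `i` almost surely starts at `i`, so agreement on paths with `i` prepended
suffices. -/
theorem lintegral_walk_congr {f g : (ℕ → V) → ℝ≥0∞} (hf : Measurable f) (hg : Measurable g)
    {i : V} (h : 0 < G.degree i) (hfg : ∀ ω, f (consPath i ω) = g (consPath i ω)) :
    ∫⁻ ω, f ω ∂G.walk i = ∫⁻ ω, g ω ∂G.walk i := by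
  simp only [lintegral_walk G hf h, lintegral_walk G hg h, hfg]

/-- Two functions are allowed because the remaining time may be of another kind: a return time
becomes a hitting time, and truncation at `n + 1` becomes truncation at `n`. -/
theorem lintegral_walk_one_add {f g : (ℕ → V) → ℝ≥0∞} (hf : Measurable f) (hg : Measurable g)
    {i : V} (h : 0 < G.degree i) (hfg : ∀ ω, f (consPath i ω) = 1 + g ω) :
    ∫⁻ ω, f ω ∂G.walk i =
      1 + ∑ j, ENNReal.ofReal (G.transition i j) * ∫⁻ ω, g ω ∂G.walk j := by
  simp only [lintegral_walk G hf h, hfg, lintegral_add_right _ hg, lintegral_const, measure_univ,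
    mul_one, mul_add, Finset.sum_add_distrib, G.sum_transition h]

theorem measureReal_walk {S T : Set (ℕ → V)} (hS : MeasurableSet S) (hT : MeasurableSet T)
    {i : V} (h : 0 < G.degree i) (hST : consPath i ⁻¹' S = T) :
    (G.walk i).real S = ∑ j, G.transition i j * (G.walk j).real T := by
  have := lintegral_walk G (measurable_one.indicator hS) h
  have hc : ∀ ω, S.indicator (1 : (ℕ → V) → ℝ≥0∞) (consPath i ω) = T.indicator 1 ω := by
    intro ω
    rw [← hST]
    rfl
  simp only [hc, lintegral_indicator_one hS, lintegral_indicator_one hT] at this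
  rw [measureReal_def, this, sum_ofReal_transition h _ fun j => measure_ne_top _ _]
  rfl

/-- Comparison of an expected time with a supersolution of its first-step equations. -/
theorem lintegral_walk_le (hdeg : ∀ i, 0 < G.degree i) {j : V} {T : (ℕ → V) → ℝ≥0∞}
    (hT : Measurable T) (hTs : ∀ k ≠ j, ∀ ω, T (consPath k ω) = 1 + T ω) {h : V → ℝ≥0∞}
    (hj : ∫⁻ ω, T ω ∂G.walk j ≤ h j)
    (hh : ∀ k ≠ j, 1 + ∑ l, ENNReal.ofReal (G.transition k l) * h l ≤ h k) (k : V) :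
    ∫⁻ ω, T ω ∂G.walk k ≤ h k := by
  have hm : ∀ n : ℕ, Measurable fun ω => min (T ω) n := fun n => hT.min measurable_const
  -- `T` may be infinite, so it is truncated at `n`; each step lowers the truncation level by one,
  -- which permits induction. Monotone convergence then removes the truncation.
  have key : ∀ (n : ℕ) (k : V), ∫⁻ ω, min (T ω) n ∂G.walk k ≤ h k := by
    intro n
    induction n with
    | zero => simp
    | succ n ih =>
      intro k
      by_cases hk : k = j
      · subst hk
        exact (lintegral_mono fun ω => min_le_left _ _).trans hj
      · rw [lintegral_walk_one_add (hm (n + 1)) (hm n) (hdeg k)]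
        · refine le_trans ?_ (hh k hk)
          gcongr with l _
          exact ih l
        · intro ω
          rw [hTs k hk, Nat.cast_add, Nat.cast_one, add_comm (n : ℝ≥0∞), min_add_add_left]
  have hsup : ∀ ω, T ω = ⨆ n : ℕ, min (T ω) n := by
    intro ω
    rw [← inf_iSup_eq, ENNReal.iSup_natCast, inf_top_eq]
  rw [lintegral_congr hsup, lintegral_iSup hm]
  · exact iSup_le fun n => key n k
  · intro m n hmn ω
    exact min_le_min_left _ (by exact_mod_cast hmn)

theorem hittingTime_self (i : V) (h : 0 < G.degree i) : G.hittingTime i i = 0 := by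
  unfold hittingTime
  rw [lintegral_walk_congr (measurable_hitting i) measurable_zero h, lintegral_zero_fun]
  exact fun ω => firstTime_of_zero rfl

theorem hittingTime_eq {j k : V} (h : 0 < G.degree k) (hk : k ≠ j) :
    G.hittingTime k j =
      1 + ∑ l, ENNReal.ofReal (G.transition k l) * G.hittingTime l j :=
  lintegral_walk_one_add (measurable_hitting j) (measurable_hitting j) h
    (firstTime_hitting_consPath hk)

theorem returnTime_eq {i : V} (h : 0 < G.degree i) :
    G.returnTime i = 1 + ∑ l, ENNReal.ofReal (G.transition i l) * G.hittingTime l i := by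
  refine lintegral_walk_one_add (measurable_return i) (measurable_hitting i) h fun ω => ?_
  rw [firstTime_succ (by simp)]
  simp [consPath]

/-- The real solution from `exists_expected_time` is a finite supersolution. Its value at `j` only
needs to be nonnegative, as `H(j,j) = 0`. -/
theorem StronglyConnected.hittingTime_ne_top (hconn : G.StronglyConnected)
    (hdeg : ∀ i, 0 < G.degree i) (k j : V) : G.hittingTime k j ≠ ⊤ := by
  obtain ⟨h, h0, hh⟩ := hconn.exists_expected_time hdeg j
  refine ne_top_of_le_ne_top (ENNReal.ofReal_ne_top (r := h k))
    (lintegral_walk_le hdeg (h := fun k => ENNReal.ofReal (h k)) (measurable_hitting j)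
      (fun k hk => firstTime_hitting_consPath hk) ?_ ?_ k)
  · exact (hittingTime_self j (hdeg j)).le.trans bot_le
  · intro k hk
    have hP : ∀ l, 0 ≤ G.transition k l := G.transition_nonneg (hdeg k)
    rw [hh k hk, ENNReal.ofReal_add zero_le_one
      (Finset.sum_nonneg fun l _ => mul_nonneg (hP l) (h0 l)), ENNReal.ofReal_one,
      ENNReal.ofReal_sum_of_nonneg fun l _ => mul_nonneg (hP l) (h0 l)]
    simp only [ENNReal.ofReal_mul (hP _)]
    exact le_rfl

theorem StronglyConnected.toReal_hittingTime (hconn : G.StronglyConnected)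
    (hdeg : ∀ i, 0 < G.degree i) {j k : V} (hk : k ≠ j) :
    (G.hittingTime k j).toReal =
      1 + ∑ l, G.transition k l * (G.hittingTime l j).toReal := by
  have hf := fun l => hconn.hittingTime_ne_top hdeg l j
  rw [hittingTime_eq (hdeg k) hk, ENNReal.toReal_add ENNReal.one_ne_top
    (sum_ofReal_transition_ne_top k hf), sum_ofReal_transition (hdeg k) _ hf, ENNReal.toReal_one]

theorem StronglyConnected.toReal_returnTime (hconn : G.StronglyConnected)
    (hdeg : ∀ i, 0 < G.degree i) (i : V) :
    (G.returnTime i).toReal =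
      1 + ∑ l, G.transition i l * (G.hittingTime l i).toReal := by
  have hf := fun l => hconn.hittingTime_ne_top hdeg l i
  rw [returnTime_eq (hdeg i), ENNReal.toReal_add ENNReal.one_ne_top
    (sum_ofReal_transition_ne_top i hf), sum_ofReal_transition (hdeg i) _ hf, ENNReal.toReal_one]

theorem StronglyConnected.returnTime_ne_top (hconn : G.StronglyConnected)
    (hdeg : ∀ i, 0 < G.degree i) (i : V) : G.returnTime i ≠ ⊤ := by
  rw [returnTime_eq (hdeg i)]
  exact ENNReal.add_ne_top.2 ⟨ENNReal.one_ne_top,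
    sum_ofReal_transition_ne_top i fun l => hconn.hittingTime_ne_top hdeg l i⟩

/-- If a time satisfies the first-step equation away from `j`, then its expectation is the expected
time until the visit to `j` plus the expectation from `j`. -/
theorem StronglyConnected.lintegral_walk_eq_hittingTime_add (hconn : G.StronglyConnected)
    (hdeg : ∀ i, 0 < G.degree i) {j : V} {T : (ℕ → V) → ℝ≥0∞}
    (hT : Measurable T) (hTs : ∀ k ≠ j, ∀ ω, T (consPath k ω) = 1 + T ω)
    (hj : ∫⁻ ω, T ω ∂G.walk j ≠ ⊤) (k : V) :
    ∫⁻ ω, T ω ∂G.walk k = G.hittingTime k j + ∫⁻ ω, T ω ∂G.walk j := by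
  have hH := fun l => hconn.hittingTime_ne_top hdeg l j
  -- The right side is a supersolution. This bound gives the finiteness needed to pass to real
  -- numbers, where `eq_of_poisson` upgrades it to equality without the strong Markov property.
  have hle : ∀ k, ∫⁻ ω, T ω ∂G.walk k ≤ G.hittingTime k j + ∫⁻ ω, T ω ∂G.walk j := by
    refine lintegral_walk_le hdeg hT hTs le_add_self fun k hk => ?_
    simp only [mul_add, Finset.sum_add_distrib, ← Finset.sum_mul, G.sum_transition (hdeg k),
      one_mul]
    rw [← add_assoc, ← hittingTime_eq (hdeg k) hk]
  have hfin : ∀ k, ∫⁻ ω, T ω ∂G.walk k ≠ ⊤ := fun k =>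
    ne_top_of_le_ne_top (ENNReal.add_ne_top.2 ⟨hH k, hj⟩) (hle k)
  have hfun : (fun k => (∫⁻ ω, T ω ∂G.walk k).toReal) =
      fun k => (G.hittingTime k j).toReal + (∫⁻ ω, T ω ∂G.walk j).toReal := by
    refine hconn.eq_of_poisson hdeg (B := {j}) (c := fun _ => 1) (Set.singleton_nonempty j)
      ?_ ?_ ?_
    · intro k hk
      rw [lintegral_walk_one_add hT hT (hdeg k) (hTs k hk), ENNReal.toReal_add ENNReal.one_ne_top
        (sum_ofReal_transition_ne_top k hfin), sum_ofReal_transition (hdeg k) _ hfin,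
        ENNReal.toReal_one]
    · intro k hk
      simp only [mul_add, Finset.sum_add_distrib, ← Finset.sum_mul,
        G.sum_transition_eq_one (hdeg k), hconn.toReal_hittingTime hdeg hk]
      ring
    · rintro k rfl
      simp [hittingTime_self k (hdeg k)]
  rw [← ENNReal.toReal_eq_toReal_iff' (hfin k) (ENNReal.add_ne_top.2 ⟨hH k, hj⟩),
    ENNReal.toReal_add (hH k) hj]
  exact congrFun hfun k

/-- From `j`, the visit to `j` has already occurred at time `0`, leaving the hitting time of `i`.
From any other state, the first step merely adds one, so `lintegral_walk_eq_hittingTime_add`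
applies. -/
theorem StronglyConnected.commuteTime_eq (hconn : G.StronglyConnected)
    (hdeg : ∀ i, 0 < G.degree i) (i j : V) :
    G.commuteTime i j = G.hittingTime i j + G.hittingTime j i := by
  have hj : ∫⁻ ω, firstTime (fun n => ω n = i ∧ ∃ m ≤ n, ω m = j) ∂G.walk j =
      G.hittingTime j i := by
    refine lintegral_walk_congr (measurable_commute i j) (measurable_hitting i) (hdeg j)
      fun ω => ?_
    congr 1
    ext n
    exact and_iff_left ⟨0, Nat.zero_le n, rfl⟩
  rw [← hj]
  refine hconn.lintegral_walk_eq_hittingTime_add hdeg (measurable_commute i j) ?_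
    (hj ▸ hconn.hittingTime_ne_top hdeg j i) i
  intro k hk ω
  rw [firstTime_succ]
  · congr 2
    ext n
    refine and_congr_right fun _ => ⟨?_, ?_⟩
    · rintro ⟨_ | m, hm, h⟩
      · exact absurd h hk
      · exact ⟨m, by omega, h⟩
    · rintro ⟨m, hm, h⟩
      exact ⟨m + 1, by omega, h⟩
  · rintro ⟨_, m, hm, h⟩
    obtain rfl : m = 0 := by omega
    exact hk h

theorem StronglyConnected.commuteTime_ne_top (hconn : G.StronglyConnected)
    (hdeg : ∀ i, 0 < G.degree i) (i j : V) : G.commuteTime i j ≠ ⊤ := by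
  rw [hconn.commuteTime_eq hdeg]
  exact ENNReal.add_ne_top.2
    ⟨hconn.hittingTime_ne_top hdeg i j, hconn.hittingTime_ne_top hdeg j i⟩

theorem StronglyConnected.toReal_commuteTime (hconn : G.StronglyConnected)
    (hdeg : ∀ i, 0 < G.degree i) (i j : V) :
    (G.commuteTime i j).toReal = (G.hittingTime i j).toReal + (G.hittingTime j i).toReal := by
  rw [hconn.commuteTime_eq hdeg, ENNReal.toReal_add (hconn.hittingTime_ne_top hdeg i j)
    (hconn.hittingTime_ne_top hdeg j i)]

theorem StronglyConnected.toReal_commuteTime_pos (hconn : G.StronglyConnected)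
    (hdeg : ∀ i, 0 < G.degree i) {i j : V} (hij : i ≠ j) : 0 < (G.commuteTime i j).toReal := by
  rw [hconn.toReal_commuteTime hdeg, hconn.toReal_hittingTime hdeg hij]
  have : 0 ≤ ∑ l, G.transition i l * (G.hittingTime l j).toReal :=
    Finset.sum_nonneg fun l _ =>
      mul_nonneg (G.transition_nonneg (hdeg i) l) ENNReal.toReal_nonneg
  linarith [ENNReal.toReal_nonneg (a := G.hittingTime j i)]

/-! ### Visiting one vertex before another, and escape probabilities. -/

theorem measurableSet_visitsBefore (j i : V) : MeasurableSet (visitsBefore j i) := by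
  have : visitsBefore j i = ⋃ n, {ω | ω n = j} ∩ ⋂ m, ⋂ (_ : m < n), {ω | ω m = i}ᶜ := by
    ext ω
    simp [visitsBefore]
  rw [this]
  exact MeasurableSet.iUnion fun n => (measurableSet_eval_eq n j).inter <|
    MeasurableSet.iInter fun m => MeasurableSet.iInter fun _ => (measurableSet_eval_eq m i).compl

theorem measureReal_visitsBefore_left (hdeg : ∀ i, 0 < G.degree i) (i j : V) :
    (G.walk j).real (visitsBefore j i) = 1 := by
  have h : consPath j ⁻¹' visitsBefore j i = Set.univ :=
    Set.eq_univ_of_forall fun ω => ⟨0, rfl, by simp⟩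
  rw [measureReal_walk (measurableSet_visitsBefore j i) MeasurableSet.univ (hdeg j) h]
  simp [G.sum_transition_eq_one (hdeg j)]

theorem measureReal_visitsBefore_right (hdeg : ∀ i, 0 < G.degree i) {i j : V} (hij : i ≠ j) :
    (G.walk i).real (visitsBefore j i) = 0 := by
  have h : consPath i ⁻¹' visitsBefore j i = ∅ := by
    refine Set.eq_empty_of_forall_notMem ?_
    rintro ω ⟨_ | n, hn, h⟩
    · exact hij hn
    · exact h 0 (Nat.succ_pos n) rfl
  rw [measureReal_walk (measurableSet_visitsBefore j i) MeasurableSet.empty (hdeg i) h]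
  simp

/-- The escape event only concerns times at least `1`; after deleting time `0` it becomes
`visitsBefore j i`. -/
theorem escapeProb_eq_sum (hdeg : ∀ i, 0 < G.degree i) (i j : V) :
    G.escapeProb i j = ∑ k, G.transition i k * (G.walk k).real (visitsBefore j i) := by
  refine measureReal_walk ?_ (measurableSet_visitsBefore j i) (hdeg i) ?_
  · have : {ω : ℕ → V | ∃ n, 1 ≤ n ∧ ω n = j ∧ ∀ m, 1 ≤ m → m < n → ω m ≠ i} =
        (fun ω n => ω (n + 1)) ⁻¹' visitsBefore j i := by
      ext ω
      constructor
      · rintro ⟨n, h1, hn, h⟩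
        obtain ⟨n, rfl⟩ := Nat.exists_eq_add_of_le' h1
        exact ⟨n, hn, fun m hm => h (m + 1) (by omega) (by omega)⟩
      · rintro ⟨n, hn, h⟩
        refine ⟨n + 1, by omega, hn, fun m h1 hm => ?_⟩
        obtain ⟨m, rfl⟩ := Nat.exists_eq_add_of_le' h1
        exact h m (by omega)
    rw [this]
    exact measurable_pi_lambda _ (fun n => measurable_pi_apply (n + 1))
      (measurableSet_visitsBefore j i)
  · ext ω
    constructor
    · rintro ⟨_ | n, h1, hn, h⟩
      · omega
      · exact ⟨n, hn, fun m hm => h (m + 1) (by omega) (by omega)⟩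
    · rintro ⟨n, hn, h⟩
      refine ⟨n + 1, by omega, hn, ?_⟩
      rintro (_ | m) h1 hm
      · omega
      · exact h m (by omega)

/-- The probability of visiting `j` before `i` in terms of hitting times. -/
theorem StronglyConnected.measureReal_visitsBefore (hconn : G.StronglyConnected)
    (hdeg : ∀ i, 0 < G.degree i) {i j : V} (hij : i ≠ j) (k : V) :
    (G.walk k).real (visitsBefore j i) =
      ((G.hittingTime k i).toReal + (G.hittingTime i j).toReal - (G.hittingTime k j).toReal) /
        (G.commuteTime i j).toReal := by
  have hC := hconn.toReal_commuteTime_pos hdeg hij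
  -- Off `{i, j}` the source terms `1` of `H(k,i)` and `H(k,j)` cancel, so the quotient is harmonic.
  -- The constant `H(i,j)` makes the numerator `0` at `i` and `C(i,j)` at `j`.
  refine congrFun (hconn.eq_of_poisson hdeg (B := {i, j}) (c := fun _ => 0)
    (f := fun k => (G.walk k).real (visitsBefore j i))
    (g := fun k => ((G.hittingTime k i).toReal + (G.hittingTime i j).toReal -
      (G.hittingTime k j).toReal) / (G.commuteTime i j).toReal)
    ⟨i, by simp⟩ ?_ ?_ ?_) k
  · intro k hk
    simp only [Set.mem_insert_iff, Set.mem_singleton_iff, not_or] at hk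
    rw [zero_add]
    exact measureReal_walk (measurableSet_visitsBefore j i) (measurableSet_visitsBefore j i)
      (hdeg k) (preimage_consPath_visitsBefore hk.1 hk.2)
  · intro k hk
    simp only [Set.mem_insert_iff, Set.mem_singleton_iff, not_or] at hk
    simp only [zero_add, mul_div_assoc', ← Finset.sum_div, mul_sub, mul_add,
      Finset.sum_sub_distrib, Finset.sum_add_distrib, ← Finset.sum_mul,
      G.sum_transition_eq_one (hdeg k)]
    rw [hconn.toReal_hittingTime hdeg hk.1, hconn.toReal_hittingTime hdeg hk.2]
    ring
  · rintro k (rfl | rfl)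
    · rw [measureReal_visitsBefore_right hdeg hij]
      simp [hittingTime_self k (hdeg k)]
    · rw [measureReal_visitsBefore_left hdeg, hittingTime_self k (hdeg k), ENNReal.toReal_zero,
        sub_zero, add_comm, ← hconn.toReal_commuteTime hdeg, div_self hC.ne']

/-- Averaging the formula over the first step from `i` gives numerator `(R i - 1) + H(i,j) - (H(i,j)
- 1) = R i`. -/
theorem StronglyConnected.escapeProb_eq (hconn : G.StronglyConnected)
    (hdeg : ∀ i, 0 < G.degree i) {i j : V} (hij : i ≠ j) :
    G.escapeProb i j = (G.returnTime i).toReal / (G.commuteTime i j).toReal := by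
  rw [escapeProb_eq_sum hdeg]
  simp only [hconn.measureReal_visitsBefore hdeg hij]
  simp only [mul_div_assoc', ← Finset.sum_div, mul_sub, mul_add,
    Finset.sum_sub_distrib, Finset.sum_add_distrib, ← Finset.sum_mul,
    G.sum_transition_eq_one (hdeg i)]
  have h := hconn.toReal_hittingTime hdeg hij
  rw [hconn.toReal_returnTime hdeg]
  congr 1
  linarith

/-! ### Kac's formula and the stationary distribution. -/

theorem StronglyConnected.invariant_mul_returnTime (hconn : G.StronglyConnected)
    (hdeg : ∀ i, 0 < G.degree i) {μ : V → ℝ} (hμ : μ ᵥ* G.transition = μ) (i : V) :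
    μ i * (G.returnTime i).toReal = ∑ k, μ k := by
  rw [hconn.toReal_returnTime hdeg]
  exact invariant_mul_expected_return (h := fun k => (G.hittingTime k i).toReal) hμ
    (by simp [hittingTime_self i (hdeg i)]) fun k hk => hconn.toReal_hittingTime hdeg hk

theorem StronglyConnected.toReal_returnTime_pos (hconn : G.StronglyConnected)
    (hdeg : ∀ i, 0 < G.degree i) (i : V) : 0 < (G.returnTime i).toReal := by
  rw [hconn.toReal_returnTime hdeg]
  have : 0 ≤ ∑ l, G.transition i l * (G.hittingTime l i).toReal :=
    Finset.sum_nonneg fun l _ =>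
      mul_nonneg (G.transition_nonneg (hdeg i) l) ENNReal.toReal_nonneg
  linarith

/-- Kac's formula holds for invariant vectors of any sign, so each is a multiple of `1 / R`. A
nonzero one therefore has nonzero sum, and normalising it shows that `1 / R` is stationary. -/
theorem StronglyConnected.isStationary_iff [Nonempty V] (hconn : G.StronglyConnected)
    (hdeg : ∀ i, 0 < G.degree i) (π : V → ℝ) :
    G.IsStationary π ↔ π = fun i => 1 / (G.returnTime i).toReal := by
  have hR := hconn.toReal_returnTime_pos hdeg
  constructor
  · rintro ⟨⟨_, h1⟩, hπ⟩
    ext i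
    rw [eq_div_iff (hR i).ne', hconn.invariant_mul_returnTime hdeg hπ, h1]
  · rintro rfl
    obtain ⟨μ, h0, hμ⟩ := exists_invariant hdeg
    have hs : ∀ i, μ i = (∑ k, μ k) * (1 / (G.returnTime i).toReal) := fun i => by
      rw [mul_one_div, eq_div_iff (hR i).ne', hconn.invariant_mul_returnTime hdeg hμ]
    have hs0 : ∑ k, μ k ≠ 0 := fun h => h0 (funext fun i => by rw [hs i, h, zero_mul]; rfl)
    have hμ' : (∑ k, μ k)⁻¹ • μ = fun i => 1 / (G.returnTime i).toReal := by
      ext i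
      rw [Pi.smul_apply, smul_eq_mul, hs i, inv_mul_cancel_left₀ hs0]
    refine ⟨⟨fun i => (one_div_pos.2 (hR i)).le, ?_⟩, ?_⟩
    · simp only [← hμ', Pi.smul_apply, smul_eq_mul, ← Finset.mul_sum, inv_mul_cancel₀ hs0]
    · rw [← hμ', Matrix.smul_vecMul, hμ]

theorem StronglyConnected.stationary_apply [Nonempty V] (hconn : G.StronglyConnected)
    (hdeg : ∀ i, 0 < G.degree i) (i : V) :
    G.stationary i = 1 / (G.returnTime i).toReal :=
  congrFun ((hconn.isStationary_iff hdeg _).1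
    (Classical.epsilon_spec ⟨_, (hconn.isStationary_iff hdeg _).2 rfl⟩)) i

end WeightedDigraph

theorem mainTheorem5 {V : Type*} [Fintype V] [Nonempty V] [MeasurableSpace V]
    [MeasurableSingletonClass V] (G : WeightedDigraph V)
    (hdeg : ∀ i, 0 < G.degree i) (hconn : G.StronglyConnected) :
    (∀ π : V → ℝ, G.IsStationary π ↔ π = G.stationary) ∧
    (∀ i, 0 < G.stationary i ∧
      G.returnTime i = ENNReal.ofReal (1 / G.stationary i)) ∧
    (∀ i j, G.commuteTime i j = G.hittingTime i j + G.hittingTime j i ∧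
      G.commuteTime i j ≠ ⊤ ∧
      G.resistance i j = (G.commuteTime i j).toReal / G.vol) ∧
    (∀ i j, i ≠ j → 0 < G.escapeProb i j ∧
      G.escapeProb i j = 1 / (G.stationary i * (G.commuteTime i j).toReal)) := by
  have hR := hconn.toReal_returnTime_pos hdeg
  have hstat := hconn.stationary_apply hdeg
  have hesc : ∀ i j, i ≠ j →
      G.escapeProb i j = 1 / (G.stationary i * (G.commuteTime i j).toReal) := by
    intro i j hij
    rw [hconn.escapeProb_eq hdeg hij, hstat, one_div_mul_eq_div, one_div_div]
  have hpos : ∀ i, 0 < G.stationary i := fun i => by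
    rw [hstat]
    exact one_div_pos.2 (hR i)
  refine ⟨fun π => ?_, fun i => ⟨hpos i, ?_⟩, fun i j => ⟨hconn.commuteTime_eq hdeg i j,
    hconn.commuteTime_ne_top hdeg i j, ?_⟩, fun i j hij => ⟨?_, hesc i j hij⟩⟩
  · rw [hconn.isStationary_iff hdeg, ← funext hstat]
  · rw [hstat, one_div_one_div, ENNReal.ofReal_toReal (hconn.returnTime_ne_top hdeg i)]
  · by_cases hij : i = j
    · subst hij
      rw [WeightedDigraph.resistance, if_pos rfl, hconn.commuteTime_eq hdeg,
        WeightedDigraph.hittingTime_self i (hdeg i)]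
      simp
    · rw [WeightedDigraph.resistance, if_neg hij, hesc i j hij, mul_assoc, mul_one_div,
        div_mul_cancel_left₀ (hpos i).ne', ← div_eq_mul_inv, one_div_div]
  · rw [hesc i j hij]
    exact one_div_pos.2 (mul_pos (hpos i) (hconn.toReal_commuteTime_pos hdeg hij))
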